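/- Let $(W_n)_{n\in\mathbb N}$ be a sequence in which each $W_n$ is one of the classical Weyl groups $S_n$, $B_n$, $D_n$ (the type may vary with $n$), and put $d_{\max}=n,\ 2n,\ 2n-2$ for $W_n=S_n,\ B_n,\ D_n$ respectively. Let $d=d(n)$ be integers with $1\le d\le d_{\max}-1$ for all sufficiently large $n$. For each $n$ let $Z_1,\dots,Z_n$ be independent random variables on a probability space, uniformly distributed on $(0,1)$ if $W_n=S_n$ and on $(-1,1)$ if $W_n=B_n$ or $W_n=D_n$. With $$\mathfrak N_{n,d}=\{(i,j)\in\{1,\dots,n\}^2 : 1\le j-i\le d\},\qquad \widetilde{\mathfrak N}_{n,d}=\{(i,j)\in\{1,\dots,n\}^2 : i<j,\ i+j\le d\},$$ the generalized inversion statistic $X_{\mathrm{inv}}^{(d)}$ is $$\sum_{(i,j)\in\mathfrak N_{n,d}}\mathbf 1\{Z_i>Z_j\}\quad\text{on } S_n,$$ $$\sum_{(i,j)\in\mathfrak N_{n,d}}\mathbf 1\{Z_i>Z_j\}+\sum_{(i,j)\in\widetilde{\mathfrak N}_{n,d}}\mathbf 1\{-Z_i>Z_j\}+\sum_{i=1}^{\min\{n,d\}}\mathbf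 1\{Z_i<0\}\quad\text{on } B_n,$$ $$\sum_{(i,j)\in\mathfrak N_{n,d}}\mathbf 1\{Z_i>Z_j\}+\sum_{(i,j)\in\widetilde{\mathfrak N}_{n,d+2}}\mathbf 1\{-Z_i>Z_j\}\quad\text{on } D_n.$$ Let $$\hat X_{\mathrm{inv}}^{(d)}=\sum_{k=1}^n\mathbb E\bigl(X_{\mathrm{inv}}^{(d)}\mid Z_k\bigr)-(n-1)\,\mathbb E\bigl(X_{\mathrm{inv}}^{(d)}\bigr)$$ be its Hájek projection with respect to $Z_1,\dots,Z_n$. Then, as $n\to\infty$, $$\mathrm{Var}\bigl(\hat X_{\mathrm{inv}}^{(d)}\bigr)\sim\mathrm{Var}\bigl(X_{\mathrm{inv}}^{(d)}\bigr)\quad\text{if and only if}\quad d\gg\sqrt n,\ \text{ i.e. } \lim_{n\to\infty}\sqrt n/d(n)=0.$$ -/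

import Mathlib

open MeasureTheory ProbabilityTheory Filter Asymptotics

/-- The three families of classical Weyl groups: the symmetric groups `S_n`, the signed permutation
groups `B_n` and the even-signed permutation groups `D_n`. -/
inductive WeylFamily
  | S
  | B
  | D

namespace WeylFamily

/-- The largest degree `d_max` of the group of rank index `n` in the family. -/
def dMax : WeylFamily → ℕ → ℕ
  | S, n => n
  | B, n => 2 * n
  | D, n => 2 * n - 2

/-- The range of the uniform variables that represent the group: `(0,1)` for `S_n` and `(-1,1)` for
`B_n` and `D_n`. -/
def range : WeylFamily → Set ℝ
  | S => Set.Ioo 0 1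
  | B => Set.Ioo (-1) 1
  | D => Set.Ioo (-1) 1

end WeylFamily

/-- The pairs `(i, j)` of indices with `1 ≤ j - i ≤ d`: the positive roots `e_i - e_j` of height
at most `d`. The element `i : Fin n` stands for the index `i + 1` in `{1, …, n}`. -/
def diffPairs (n d : ℕ) : Finset (Fin n × Fin n) :=
  Finset.univ.filter fun p => p.1 < p.2 ∧ (p.2 : ℕ) ≤ (p.1 : ℕ) + d

/-- The pairs `(i, j)` of indices with `i < j` and `i + j ≤ d`. The element `i : Fin n` stands for
the index `i + 1` in `{1, …, n}`, hence the shifts by one. -/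
def sumPairs (n d : ℕ) : Finset (Fin n × Fin n) :=
  Finset.univ.filter fun p => p.1 < p.2 ∧ ((p.1 : ℕ) + 1) + ((p.2 : ℕ) + 1) ≤ d

/-- `∑ 1{z_i > z_j}` over the pairs with `1 ≤ j - i ≤ d`. -/
noncomputable def diffInv (n d : ℕ) (z : Fin n → ℝ) : ℝ :=
  ∑ p ∈ diffPairs n d, if z p.1 > z p.2 then 1 else 0

/-- `∑ 1{-z_i > z_j}` over the pairs with `i < j` and `i + j ≤ d`. -/
noncomputable def sumInv (n d : ℕ) (z : Fin n → ℝ) : ℝ :=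
  ∑ p ∈ sumPairs n d, if -z p.1 > z p.2 then 1 else 0

/-- `∑ 1{z_i < 0}` over the indices `1 ≤ i ≤ min n d`. -/
noncomputable def negCount (n d : ℕ) (z : Fin n → ℝ) : ℝ :=
  ∑ i ∈ Finset.univ.filter (fun i : Fin n => (i : ℕ) + 1 ≤ d), if z i < 0 then 1 else 0

/-- The number of `d`-inversions (inversions at positive roots of height at most `d`), as a function
of the values `z_1, …, z_n` of the representing variables. -/
noncomputable def genInv : WeylFamily → (n d : ℕ) → (Fin n → ℝ) → ℝ
  | .S, n, d, z => diffInv n d z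
  | .B, n, d, z => diffInv n d z + sumInv n d z + negCount n d z
  | .D, n, d, z => diffInv n d z + sumInv n (d + 2) z

/-- The Hájek projection `∑ k, E(X | Z_k) - (n - 1) E(X)` of `X` with respect to `Z_1, …, Z_n`. -/
noncomputable def hajekProjection {Ω : Type*} [MeasurableSpace Ω] (μ : Measure Ω) {n : ℕ}
    (Z : Fin n → Ω → ℝ) (X : Ω → ℝ) : Ω → ℝ :=
  fun ω => ∑ k, (μ[X | MeasurableSpace.comap (Z k) (borel ℝ)]) ω - ((n : ℝ) - 1) * ∫ ω', X ω' ∂μ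

/-!
Writing the indicators of `Z_i > Z_j` and `-Z_i > Z_j` as their conditional expectations given `Z_i`
and `Z_j` plus a degenerate remainder gives the Hoeffding decomposition of the statistic into a
constant, main effects of the single variables and pairwise uncorrelated interactions. The Hájek
projection keeps exactly the main effects. Their coefficients cancel except at `O(d)` indices near
the two ends of `{1, …, n}`, where they are `O(d)`, and they do have order `d` at a positive
proportion of the last `d` indices, so the projection has variance of order `d ^ 3`. The
interactions have variance `1 / 12` per indicator, of total order `n * d`. Hence the two variances
are equivalent iff `n * d = o(d ^ 3)`, that is, `√n = o(d)`.
-/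

section Degenerate

variable {E : Type*} [MeasurableSpace E] {ν : Measure E}

/-- A degenerate (or canonical) kernel: a square-integrable function of two variables whose partial
integral over either variable vanishes. The interaction terms of a Hoeffding decomposition have this
form. -/
structure IsDegenerate (g : E × E → ℝ) (ν : Measure E) : Prop where
  measurable : Measurable g
  memLp : MemLp g 2 (ν.prod ν)
  integral_fst : ∀ᵐ y ∂ν, ∫ x, g (x, y) ∂ν = 0
  integral_snd : ∀ᵐ x ∂ν, ∫ y, g (x, y) ∂ν = 0

/-- A centered square-integrable function of one variable: a main effect of a Hoeffding
decomposition. -/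
structure IsCentered (f : E → ℝ) (ν : Measure E) : Prop where
  measurable : Measurable f
  memLp : MemLp f 2 ν
  integral_eq_zero : ∫ x, f x ∂ν = 0

namespace IsDegenerate

variable {g h : E × E → ℝ}

theorem swap [SFinite ν] (hg : IsDegenerate g ν) : IsDegenerate (g ∘ Prod.swap) ν where
  measurable := hg.measurable.comp measurable_swap
  memLp := hg.memLp.comp_measurePreserving Measure.measurePreserving_swap
  integral_fst := hg.integral_snd
  integral_snd := hg.integral_fst

theorem const_mul (c : ℝ) (hg : IsDegenerate g ν) : IsDegenerate (fun p => c * g p) ν where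
  measurable := hg.measurable.const_mul c
  memLp := hg.memLp.const_mul c
  integral_fst := by
    filter_upwards [hg.integral_fst] with y hy
    rw [integral_const_mul, hy, mul_zero]
  integral_snd := by
    filter_upwards [hg.integral_snd] with x hx
    rw [integral_const_mul, hx, mul_zero]

theorem integrable [IsFiniteMeasure ν] (hg : IsDegenerate g ν) : Integrable g (ν.prod ν) :=
  hg.memLp.integrable one_le_two

theorem add [IsFiniteMeasure ν] (hg : IsDegenerate g ν) (hh : IsDegenerate h ν) :
    IsDegenerate (fun p => g p + h p) ν where
  measurable := hg.measurable.add hh.measurable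
  memLp := hg.memLp.add hh.memLp
  integral_fst := by
    filter_upwards [hg.integral_fst, hh.integral_fst, hg.integrable.prod_left_ae,
      hh.integrable.prod_left_ae] with y hgy hhy hgi hhi
    rw [integral_add hgi hhi, hgy, hhy, add_zero]
  integral_snd := by
    filter_upwards [hg.integral_snd, hh.integral_snd, hg.integrable.prod_right_ae,
      hh.integrable.prod_right_ae] with x hgx hhx hgi hhi
    rw [integral_add hgi hhi, hgx, hhx, add_zero]

end IsDegenerate

end Degenerate

section Conditioning

theorem integral_mul_eq_zero_of_condExp {Ω : Type*} {m mΩ : MeasurableSpace Ω}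
    {μ : Measure Ω} [IsFiniteMeasure μ] (hm : m ≤ mΩ) {f h : Ω → ℝ} (hf : Integrable f μ)
    (hfm : μ[f | m] =ᵐ[μ] 0) (hh : StronglyMeasurable[m] h) (hfh : Integrable (f * h) μ) :
    ∫ ω, f ω * h ω ∂μ = 0 := by
  calc ∫ ω, f ω * h ω ∂μ = ∫ ω, μ[f * h | m] ω ∂μ := (integral_condExp hm).symm
    _ = ∫ _, 0 ∂μ := by
        refine integral_congr_ae ?_
        filter_upwards [condExp_mul_of_stronglyMeasurable_right hh hfh hf, hfm] with ω h₁ h₂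
        rw [h₁, Pi.mul_apply, h₂, Pi.zero_apply, zero_mul]
    _ = 0 := integral_zero _ _

variable {Ω E F : Type*} [MeasurableSpace Ω] [MeasurableSpace E] [MeasurableSpace F]
  {μ : Measure Ω} [IsProbabilityMeasure μ]

theorem measurePreserving_prodMk_of_indepFun {X : Ω → E} {Y : Ω → F} {ν : Measure E}
    {ν' : Measure F} (hX : MeasurePreserving X μ ν) (hY : MeasurePreserving Y μ ν')
    (hXY : IndepFun X Y μ) : MeasurePreserving (fun ω => (X ω, Y ω)) μ (ν.prod ν') where
  measurable := hX.measurable.prodMk hY.measurable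
  map_eq := by
    rw [(indepFun_iff_map_prod_eq_prod_map_map hX.aemeasurable hY.aemeasurable).1 hXY, hX.map_eq,
      hY.map_eq]

theorem condExp_comp_prodMk_ae_eq_zero {X : Ω → E} {Y : Ω → F} {ν : Measure E} {ν' : Measure F}
    (hX : MeasurePreserving X μ ν) (hY : MeasurePreserving Y μ ν') (hXY : IndepFun X Y μ)
    {G : E × F → ℝ} (hG : Integrable G (ν.prod ν')) (hzero : ∀ᵐ y ∂ν', ∫ x, G (x, y) ∂ν = 0) :
    μ[fun ω => G (X ω, Y ω) | MeasurableSpace.comap Y inferInstance] =ᵐ[μ] 0 := by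
  have : IsProbabilityMeasure ν := hX.map_eq ▸ Measure.isProbabilityMeasure_map hX.aemeasurable
  have : IsProbabilityMeasure ν' := hY.map_eq ▸ Measure.isProbabilityMeasure_map hY.aemeasurable
  have hlaw := measurePreserving_prodMk_of_indepFun hX hY hXY
  refine (ae_eq_condExp_of_forall_setIntegral_eq hY.measurable.comap_le
    (hlaw.integrable_comp_of_integrable hG) (fun _ _ _ => integrableOn_zero) ?_
    aestronglyMeasurable_zero).symm
  rintro _ ⟨t, ht, rfl⟩ -
  symm
  calc ∫ ω in Y ⁻¹' t, G (X ω, Y ω) ∂μ = ∫ p in Set.univ ×ˢ t, G p ∂ν.prod ν' := by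
        have hset : Y ⁻¹' t = (fun ω => (X ω, Y ω)) ⁻¹' (Set.univ ×ˢ t) := by ext; simp
        rw [← hlaw.map_eq, setIntegral_map (MeasurableSet.univ.prod ht)
          (hlaw.map_eq ▸ hG.aestronglyMeasurable) hlaw.aemeasurable, hset]
    _ = ∫ y in t, ∫ x, G (x, y) ∂ν ∂ν' := by
        rw [← Measure.prod_restrict, Measure.restrict_univ, integral_prod_symm]
        exact hG.mono_measure (Measure.prod_mono le_rfl Measure.restrict_le_self)
    _ = ∫ ω in Y ⁻¹' t, (0 : Ω → ℝ) ω ∂μ := by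
        simp [integral_congr_ae (ae_restrict_of_ae hzero)]

end Conditioning

section Hoeffding

/-- The family `U` with its `i`-th member left out. -/
def leaveOneOut {ι Ω E : Type*} (U : ι → Ω → E) (i : ι) (ω : Ω) (l : {l // l ≠ i}) : E := U l ω

theorem measurable_comap_leaveOneOut {ι Ω E : Type*} [MeasurableSpace E] (U : ι → Ω → E)
    {i k : ι} (hki : k ≠ i) :
    Measurable[MeasurableSpace.comap (leaveOneOut U i) inferInstance] (U k) :=
  (measurable_pi_apply (⟨k, hki⟩ : {l // l ≠ i})).comp (comap_measurable (leaveOneOut U i))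

variable {ι Ω E : Type*} [MeasurableSpace Ω] [MeasurableSpace E] {μ : Measure Ω}
  {ν : Measure E} {U : ι → Ω → E}

theorem measurable_leaveOneOut (hU : ∀ k, Measurable (U k)) (i : ι) :
    Measurable (leaveOneOut U i) :=
  measurable_pi_lambda _ fun l => hU l

theorem indepFun_leaveOneOut [Finite ι] (hU : ∀ k, Measurable (U k)) (hindep : iIndepFun U μ)
    (i : ι) : IndepFun (U i) (leaveOneOut U i) μ := by
  classical
  have := Fintype.ofFinite ι
  have hfst : Measurable fun x : ({i} : Finset ι) → E => x ⟨i, Finset.mem_singleton_self i⟩ :=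
    measurable_pi_apply _
  have hsnd : Measurable fun (y : ({i}ᶜ : Finset ι) → E) (l : {l // l ≠ i}) =>
      y ⟨l, by simpa using l.2⟩ :=
    measurable_pi_lambda _ fun _ => measurable_pi_apply _
  exact (hindep.indepFun_finset {i} {i}ᶜ disjoint_compl_right hU).comp hfst hsnd

variable [IsProbabilityMeasure μ] (hU : ∀ k, MeasurePreserving (U k) μ ν)
  (hindep : iIndepFun U μ) {g : E × E → ℝ} (hg : IsDegenerate g ν)

include hU hindep

theorem measurePreserving_pair {i j : ι} (hij : i ≠ j) :
    MeasurePreserving (fun ω => (U i ω, U j ω)) μ (ν.prod ν) :=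
  measurePreserving_prodMk_of_indepFun (hU i) (hU j) (hindep.indepFun hij)

include hg

theorem IsDegenerate.memLp_pair {i j : ι} (hij : i ≠ j) : MemLp (fun ω => g (U i ω, U j ω)) 2 μ :=
  hg.memLp.comp_measurePreserving (measurePreserving_pair hU hindep hij)

variable [Finite ι]

namespace IsDegenerate

theorem condExp_leaveOneOut_fst {i j : ι} (hij : i ≠ j) :
    μ[fun ω => g (U i ω, U j ω) | MeasurableSpace.comap (leaveOneOut U i) inferInstance]
      =ᵐ[μ] 0 := by
  have hout := measurable_leaveOneOut (fun k => (hU k).measurable) i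
  have heval : MeasurePreserving (fun w : {l // l ≠ i} → E => w ⟨j, hij.symm⟩)
      (μ.map (leaveOneOut U i)) ν :=
    ⟨measurable_pi_apply _, by
      rw [Measure.map_map (measurable_pi_apply _) hout, ← (hU j).map_eq]; rfl⟩
  have : IsProbabilityMeasure ν :=
    (hU i).map_eq ▸ Measure.isProbabilityMeasure_map (hU i).aemeasurable
  have : IsProbabilityMeasure (μ.map (leaveOneOut U i)) :=
    Measure.isProbabilityMeasure_map hout.aemeasurable
  exact condExp_comp_prodMk_ae_eq_zero (hU i) ⟨hout, rfl⟩
    (indepFun_leaveOneOut (fun k => (hU k).measurable) hindep i)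
    (G := fun p => g (p.1, p.2 ⟨j, hij.symm⟩))
    (((MeasurePreserving.id ν).prod heval).integrable_comp_of_integrable hg.integrable)
    (heval.quasiMeasurePreserving.ae hg.integral_fst)

theorem condExp_leaveOneOut {i j l : ι} (hij : i ≠ j) (hl : l = i ∨ l = j) :
    μ[fun ω => g (U i ω, U j ω) | MeasurableSpace.comap (leaveOneOut U l) inferInstance]
      =ᵐ[μ] 0 := by
  have : IsProbabilityMeasure ν :=
    (hU i).map_eq ▸ Measure.isProbabilityMeasure_map (hU i).aemeasurable
  obtain rfl | rfl := hl
  · exact hg.condExp_leaveOneOut_fst hU hindep hij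
  · exact hg.swap.condExp_leaveOneOut_fst hU hindep hij.symm

theorem condExp_eq_zero {i j : ι} (hij : i ≠ j) (k : ι) :
    μ[fun ω => g (U i ω, U j ω) | MeasurableSpace.comap (U k) inferInstance] =ᵐ[μ] 0 := by
  obtain ⟨l, hl, hkl⟩ : ∃ l, (l = i ∨ l = j) ∧ k ≠ l := by
    by_cases hki : k = i
    · exact ⟨j, Or.inr rfl, hki ▸ hij⟩
    · exact ⟨i, Or.inl rfl, hki⟩
  have hle := (measurable_leaveOneOut (fun k => (hU k).measurable) l).comap_le
  refine (condExp_condExp_of_le (measurable_comap_leaveOneOut U hkl).comap_le hle).symm.trans ?_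
  refine (condExp_congr_ae (hg.condExp_leaveOneOut hU hindep hij hl)).trans ?_
  rw [condExp_zero]

theorem integral_eq_zero {i j : ι} (hij : i ≠ j) : ∫ ω, g (U i ω, U j ω) ∂μ = 0 := by
  have h := integral_condExp (hU i).measurable.comap_le (f := fun ω => g (U i ω, U j ω)) (μ := μ)
  rw [← h, integral_congr_ae (hg.condExp_eq_zero hU hindep hij i)]
  simp

theorem covariance_eq_zero {i j l : ι} (hij : i ≠ j) (hl : l = i ∨ l = j) {h : Ω → ℝ}
    (hh : StronglyMeasurable[MeasurableSpace.comap (leaveOneOut U l) inferInstance] h)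
    (hh₂ : MemLp h 2 μ) : cov[fun ω => g (U i ω, U j ω), h; μ] = 0 := by
  have hmem := hg.memLp_pair hU hindep hij
  have hle := (measurable_leaveOneOut (fun k => (hU k).measurable) l).comap_le
  rw [covariance_eq_sub hmem hh₂, hg.integral_eq_zero hU hindep hij, zero_mul, sub_zero]
  exact integral_mul_eq_zero_of_condExp hle (hmem.integrable one_le_two)
    (hg.condExp_leaveOneOut hU hindep hij hl) hh (hmem.integrable_mul hh₂)

theorem variance_eq {i j : ι} (hij : i ≠ j) :
    Var[fun ω => g (U i ω, U j ω); μ] = ∫ p, g p ^ 2 ∂ν.prod ν := by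
  have hlaw := measurePreserving_pair hU hindep hij
  rw [variance_of_integral_eq_zero (hg.memLp_pair hU hindep hij).aemeasurable
    (hg.integral_eq_zero hU hindep hij), ← hlaw.map_eq, integral_map hlaw.aemeasurable
    (hg.measurable.pow_const 2).aestronglyMeasurable]

end IsDegenerate

end Hoeffding

section HoeffdingSum

/-- A function of independent variables written as a constant, main effects `f k` of the single
variables and interactions `g p` of the pairs `p ∈ P`. -/
def hoeffdingSum {ι E : Type*} [Fintype ι] (m : ℝ) (f : ι → E → ℝ) (P : Finset (ι × ι))
    (g : ι × ι → E × E → ℝ) (x : ι → E) : ℝ :=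
  m + ∑ k, f k (x k) + ∑ p ∈ P, g p (x p.1, x p.2)

variable {ι Ω E : Type*} [MeasurableSpace Ω] [MeasurableSpace E] {μ : Measure Ω}
  {ν : Measure E} {U : ι → Ω → E} (hU : ∀ k, MeasurePreserving (U k) μ ν) (hindep : iIndepFun U μ)
  {f : ι → E → ℝ} (hf : ∀ k, IsCentered (f k) ν)
  {g : ι × ι → E × E → ℝ} (hg : ∀ p, IsDegenerate (g p) ν)

section Linear

include hU hf

theorem memLp_comp_centered (k : ι) : MemLp (fun ω => f k (U k ω)) 2 μ :=
  (hf k).memLp.comp_measurePreserving (hU k)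

theorem integral_comp_centered (k : ι) : ∫ ω, f k (U k ω) ∂μ = 0 := by
  rw [← (hf k).integral_eq_zero, ← (hU k).map_eq, integral_map (hU k).aemeasurable
    (hf k).measurable.aestronglyMeasurable]

include hindep

theorem variance_sum_centered [Fintype ι] :
    Var[fun ω => ∑ k, f k (U k ω); μ] = ∑ k, ∫ x, f k x ^ 2 ∂ν := by
  have hsum : (fun ω => ∑ k, f k (U k ω)) = ∑ k, fun ω => f k (U k ω) := by ext; simp
  rw [hsum, IndepFun.variance_sum (fun k _ => memLp_comp_centered hU hf k)
    fun i _ j _ hij => (hindep.indepFun hij).comp (hf i).measurable (hf j).measurable]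
  refine Finset.sum_congr rfl fun k _ => ?_
  rw [variance_of_integral_eq_zero (memLp_comp_centered hU hf k).aemeasurable
    (integral_comp_centered hU hf k), ← (hU k).map_eq, integral_map (hU k).aemeasurable
    ((hf k).measurable.pow_const 2).aestronglyMeasurable]

theorem condExp_comp_centered [IsProbabilityMeasure μ] [DecidableEq ι] (i k : ι) :
    μ[fun ω => f i (U i ω) | MeasurableSpace.comap (U k) inferInstance]
      =ᵐ[μ] fun ω => if i = k then f k (U k ω) else 0 := by
  have hmeas (l : ι) :
      StronglyMeasurable[MeasurableSpace.comap (U l) inferInstance] fun ω => f l (U l ω) :=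
    ((hf l).measurable.comp (comap_measurable (U l))).stronglyMeasurable
  split_ifs with hik
  · subst hik
    exact .of_eq (condExp_of_stronglyMeasurable (hU i).measurable.comap_le (hmeas i)
      ((memLp_comp_centered hU hf i).integrable one_le_two))
  · refine (condExp_indep_eq (hU i).measurable.comap_le (hU k).measurable.comap_le (hmeas i)
      (hindep.indepFun hik)).trans (.of_eq ?_)
    rw [integral_comp_centered hU hf i]

end Linear

section Interaction

variable [IsProbabilityMeasure μ] [LinearOrder ι] {P : Finset (ι × ι)} (hP : ∀ p ∈ P, p.1 < p.2)

include hU hindep hf hg in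
theorem covariance_degenerate_centered [Finite ι] {p : ι × ι} (hp : p.1 < p.2) (k : ι) :
    cov[fun ω => g p (U p.1 ω, U p.2 ω), fun ω => f k (U k ω); μ] = 0 := by
  obtain ⟨l, hl, hkl⟩ : ∃ l, (l = p.1 ∨ l = p.2) ∧ k ≠ l := by
    by_cases hki : k = p.1
    · exact ⟨p.2, Or.inr rfl, hki ▸ hp.ne⟩
    · exact ⟨p.1, Or.inl rfl, hki⟩
  exact (hg p).covariance_eq_zero hU hindep hp.ne hl
    ((hf k).measurable.comp (measurable_comap_leaveOneOut U hkl)).stronglyMeasurable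
    (memLp_comp_centered hU hf k)

include hU hindep hg

theorem covariance_degenerate_degenerate [Finite ι] {p q : ι × ι} (hp : p.1 < p.2)
    (hq : q.1 < q.2) (hpq : p ≠ q) :
    cov[fun ω => g p (U p.1 ω, U p.2 ω), fun ω => g q (U q.1 ω, U q.2 ω); μ] = 0 := by
  obtain ⟨l, hl, h₁, h₂⟩ : ∃ l, (l = p.1 ∨ l = p.2) ∧ q.1 ≠ l ∧ q.2 ≠ l := by
    by_contra! h
    rcases eq_or_ne q.1 p.1 with h₁ | h₁
    · exact hpq (Prod.ext h₁ (h p.2 (Or.inr rfl) (h₁ ▸ hp.ne))).symm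
    · have h₂ := h p.1 (Or.inl rfl) h₁
      have h₃ := h p.2 (Or.inr rfl) ((h₂ ▸ hq).trans hp).ne
      exact hp.ne (h₂.symm.trans h₃)
  exact (hg p).covariance_eq_zero hU hindep hp.ne hl
    ((hg q).measurable.comp ((measurable_comap_leaveOneOut U h₁).prodMk
      (measurable_comap_leaveOneOut U h₂))).stronglyMeasurable
    ((hg q).memLp_pair hU hindep hq.ne)

include hP

theorem variance_sum_degenerate [Finite ι] :
    Var[fun ω => ∑ p ∈ P, g p (U p.1 ω, U p.2 ω); μ] =
      ∑ p ∈ P, ∫ x, g p x ^ 2 ∂ν.prod ν := by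
  have hmem (p) (hp : p ∈ P) := (hg p).memLp_pair hU hindep (hP p hp).ne
  rw [variance_fun_sum' hmem]
  refine Finset.sum_congr rfl fun p hp => ?_
  rw [Finset.sum_eq_single_of_mem p hp fun q hq hqp =>
    covariance_degenerate_degenerate hU hindep hg (hP p hp) (hP q hq) hqp.symm,
    covariance_self (hmem p hp).aemeasurable, (hg p).variance_eq hU hindep (hP p hp).ne]

include hf

theorem variance_hoeffdingSum [Fintype ι] (m : ℝ) :
    Var[fun ω => hoeffdingSum m f P g fun k => U k ω; μ] =
      ∑ k, ∫ x, f k x ^ 2 ∂ν + ∑ p ∈ P, ∫ x, g p x ^ 2 ∂ν.prod ν := by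
  have hlin (k) := memLp_comp_centered hU hf k
  have hint (p) (hp : p ∈ P) := (hg p).memLp_pair hU hindep (hP p hp).ne
  have hL := memLp_finsetSum Finset.univ fun k _ => hlin k
  have hQ := memLp_finsetSum P hint
  have hcov : cov[fun ω => ∑ p ∈ P, g p (U p.1 ω, U p.2 ω), fun ω => ∑ k, f k (U k ω); μ] = 0 := by
    rw [covariance_fun_sum_fun_sum' hint fun k _ => hlin k]
    exact Finset.sum_eq_zero fun p hp => Finset.sum_eq_zero fun k _ =>
      covariance_degenerate_centered hU hindep hf hg (hP p hp) k
  have hsum : (fun ω => hoeffdingSum m f P g fun k => U k ω) = fun ω =>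
      ((fun ω => ∑ p ∈ P, g p (U p.1 ω, U p.2 ω)) + fun ω => ∑ k, f k (U k ω)) ω + m := by
    ext ω
    simp only [hoeffdingSum, Pi.add_apply]
    ring
  rw [hsum, variance_add_const (hQ.add hL).aestronglyMeasurable, variance_add hQ hL, hcov,
    variance_sum_degenerate hU hindep hg hP, variance_sum_centered hU hindep hf]
  ring

theorem integral_hoeffdingSum [Fintype ι] (m : ℝ) :
    ∫ ω, hoeffdingSum m f P g (fun k => U k ω) ∂μ = m := by
  have hlin (k) := (memLp_comp_centered hU hf k).integrable one_le_two
  have hint (p) (hp : p ∈ P) := ((hg p).memLp_pair hU hindep (hP p hp).ne).integrable one_le_two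
  have hL := integrable_finsetSum Finset.univ fun k _ => hlin k
  have hmL : Integrable (fun ω => m + ∑ k, f k (U k ω)) μ := (integrable_const m).add hL
  simp only [hoeffdingSum]
  rw [integral_add hmL (integrable_finsetSum P hint),
    integral_add (integrable_const m) hL, integral_finsetSum _ fun k _ => hlin k,
    integral_finsetSum _ hint, Finset.sum_eq_zero fun k _ => integral_comp_centered hU hf k,
    Finset.sum_eq_zero fun p hp => (hg p).integral_eq_zero hU hindep (hP p hp).ne]
  simp

theorem condExp_hoeffdingSum [Fintype ι] (m : ℝ) (k : ι) :
    μ[fun ω => hoeffdingSum m f P g fun l => U l ω | MeasurableSpace.comap (U k) inferInstance]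
      =ᵐ[μ] fun ω => m + f k (U k ω) := by
  have hle := (hU k).measurable.comap_le
  have hlin (i) := (memLp_comp_centered hU hf i).integrable one_le_two
  have hint (p) (hp : p ∈ P) := ((hg p).memLp_pair hU hindep (hP p hp).ne).integrable one_le_two
  have hsum : (fun ω => hoeffdingSum m f P g fun l => U l ω) =
      (fun _ => m) + ∑ i, (fun ω => f i (U i ω)) + ∑ p ∈ P, fun ω => g p (U p.1 ω, U p.2 ω) := by
    ext ω
    simp only [hoeffdingSum, Pi.add_apply, Finset.sum_apply]
  have hL := integrable_finsetSum' Finset.univ fun i _ => hlin i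
  have hzero : ∀ᵐ ω ∂μ, ∀ p ∈ P, μ[fun ω => g p (U p.1 ω, U p.2 ω) |
      MeasurableSpace.comap (U k) inferInstance] ω = 0 :=
    (Finset.eventually_all P).2 fun p hp => (hg p).condExp_eq_zero hU hindep (hP p hp).ne k
  have hlin' : ∀ᵐ ω ∂μ, ∀ i, μ[fun ω => f i (U i ω) |
      MeasurableSpace.comap (U k) inferInstance] ω = if i = k then f k (U k ω) else 0 :=
    eventually_all.2 fun i => condExp_comp_centered hU hindep hf i k
  rw [hsum]
  filter_upwards [hzero, hlin',
    condExp_add ((integrable_const m).add hL) (integrable_finsetSum' P hint) _,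
    condExp_add (integrable_const m) hL (MeasurableSpace.comap (U k) inferInstance),
    condExp_finsetSum (fun i _ => hlin i) (MeasurableSpace.comap (U k) inferInstance),
    condExp_finsetSum hint (MeasurableSpace.comap (U k) inferInstance)] with ω h₁ h₂ h₃ h₄ h₅ h₆
  rw [h₃, Pi.add_apply, h₄, Pi.add_apply, h₅, h₆, condExp_const hle]
  simp [h₂, Finset.sum_eq_zero h₁]

end Interaction

end HoeffdingSum

section Hajek

theorem hajekProjection_comp {Ω : Type*} [MeasurableSpace Ω] (μ : Measure Ω) {n : ℕ}
    (Z : Fin n → Ω → ℝ) (X : Ω → ℝ) {φ : ℝ → ℝ} (hφ : MeasurableEmbedding φ) :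
    hajekProjection μ (fun k ω => φ (Z k ω)) X = hajekProjection μ Z X := by
  have hcomap (k : Fin n) : MeasurableSpace.comap (fun ω => φ (Z k ω)) (borel ℝ) =
      MeasurableSpace.comap (Z k) (borel ℝ) :=
    MeasurableSpace.comap_comp.symm.trans (congrArg _ hφ.comap_eq)
  unfold hajekProjection
  simp only [hcomap]

variable {Ω : Type*} [MeasurableSpace Ω] {μ : Measure Ω} [IsProbabilityMeasure μ] {ν : Measure ℝ}
  {n : ℕ} {U : Fin n → Ω → ℝ} (hU : ∀ k, MeasurePreserving (U k) μ ν) (hindep : iIndepFun U μ)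
  {f : Fin n → ℝ → ℝ} (hf : ∀ k, IsCentered (f k) ν)
  {g : Fin n × Fin n → ℝ × ℝ → ℝ} (hg : ∀ p, IsDegenerate (g p) ν)
  {P : Finset (Fin n × Fin n)} (hP : ∀ p ∈ P, p.1 < p.2)

include hU hindep hf hg hP

theorem hajekProjection_hoeffdingSum (m : ℝ) :
    hajekProjection μ U (fun ω => hoeffdingSum m f P g fun k => U k ω)
      =ᵐ[μ] fun ω => ∑ k, f k (U k ω) + m := by
  have hcond := eventually_all.2 fun k => condExp_hoeffdingSum hU hindep hf hg hP m k
  filter_upwards [hcond] with ω hω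
  calc hajekProjection μ U (fun ω => hoeffdingSum m f P g fun k => U k ω) ω
      = ∑ k, (m + f k (U k ω)) - ((n : ℝ) - 1) * m := by
        rw [hajekProjection, integral_hoeffdingSum hU hindep hf hg hP m]
        exact congrArg (· - _) (Finset.sum_congr rfl fun k _ => hω k)
    _ = ∑ k, f k (U k ω) + m := by
        rw [Finset.sum_add_distrib, Finset.sum_const, Finset.card_fin, nsmul_eq_mul]
        ring

theorem variance_hajekProjection_hoeffdingSum (m : ℝ) :
    Var[hajekProjection μ U fun ω => hoeffdingSum m f P g fun k => U k ω; μ] =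
      ∑ k, ∫ x, f k x ^ 2 ∂ν := by
  rw [variance_congr (hajekProjection_hoeffdingSum hU hindep hf hg hP m), variance_add_const
    (memLp_finsetSum Finset.univ fun k _ => memLp_comp_centered hU hf k).aestronglyMeasurable,
    variance_sum_centered hU hindep hf]

end Hajek

section UniformLaw

theorem measurePreserving_cond_preimage {α β : Type*} [MeasurableSpace α] [MeasurableSpace β]
    {μ : Measure α} {ν : Measure β} {φ : α → β} (hφ : Measurable φ) {c : ENNReal} (hc : c ≠ 0)
    (hc' : c ≠ ⊤) (hmap : μ.map φ = c • ν) {s : Set β} (hs : MeasurableSet s) :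
    MeasurePreserving φ μ[|φ ⁻¹' s] ν[|s] := by
  refine ⟨hφ, ?_⟩
  rw [ProbabilityTheory.cond, ProbabilityTheory.cond, Measure.map_smul,
    ← Measure.restrict_map hφ hs, ← Measure.map_apply hφ hs, hmap, Measure.restrict_smul, smul_smul,
    Measure.smul_apply, smul_eq_mul, ENNReal.mul_inv (.inl hc) (.inl hc'), mul_right_comm,
    ENNReal.inv_mul_cancel hc hc', one_mul]

/-- The uniform distribution on `(-1, 1)`. -/
noncomputable def symmUniform : Measure ℝ := volume[|Set.Ioo (-1) 1]

theorem symmUniform_eq_smul :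
    symmUniform = (2 : ENNReal)⁻¹ • volume.restrict (Set.Ioo (-1) 1) := by
  rw [symmUniform, ProbabilityTheory.cond, Real.volume_Ioo]
  norm_num

instance : IsProbabilityMeasure symmUniform :=
  cond_isProbabilityMeasure_of_finite (by rw [Real.volume_Ioo]; norm_num) measure_Ioo_lt_top.ne

instance : NullSingletonClass symmUniform :=
  ⟨fun x => cond_absolutelyContinuous (measure_singleton x)⟩

theorem ae_symmUniform_mem : ∀ᵐ x ∂symmUniform, x ∈ Set.Ioo (-1 : ℝ) 1 :=
  ae_cond_mem measurableSet_Ioo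

theorem measurePreserving_neg_symmUniform :
    MeasurePreserving (fun x : ℝ => -x) symmUniform symmUniform := by
  have h := (Measure.measurePreserving_neg (volume : Measure ℝ)).restrict_preimage
    (measurableSet_Ioo (a := (-1 : ℝ)) (b := 1))
  rw [symmUniform_eq_smul]
  refine MeasurePreserving.smul_measure ?_ _
  simpa using! h

theorem integral_symmUniform (F : ℝ → ℝ) :
    ∫ x, F x ∂symmUniform = (∫ x in (-1)..1, F x) / 2 := by
  rw [symmUniform_eq_smul, integral_smul_measure, ← integral_Ioc_eq_integral_Ioo,
    ← intervalIntegral.integral_of_le (by norm_num), smul_eq_mul, ENNReal.toReal_inv,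
    ENNReal.toReal_ofNat, div_eq_inv_mul]

theorem integral_symmUniform_of_piecewise {F φ ψ : ℝ → ℝ} {y : ℝ} (hy : y ∈ Set.Icc (-1) 1)
    (hφ : Continuous φ) (hψ : Continuous ψ) (hl : ∀ x < y, F x = φ x) (hr : ∀ x > y, F x = ψ x) :
    ∫ x, F x ∂symmUniform = ((∫ x in (-1)..y, φ x) + ∫ x in y..1, ψ x) / 2 := by
  have hl' : (Set.uIoo (-1) y).EqOn φ F := by
    rw [Set.uIoo_of_le hy.1]; exact fun x hx => (hl x hx.2).symm
  have hr' : (Set.uIoo y 1).EqOn ψ F := by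
    rw [Set.uIoo_of_le hy.2]; exact fun x hx => (hr x hx.1).symm
  rw [integral_symmUniform, ← intervalIntegral.integral_add_adjacent_intervals
    ((hφ.intervalIntegrable _ _).congr_uIoo hl') ((hψ.intervalIntegrable _ _).congr_uIoo hr'),
    intervalIntegral.integral_congr_uIoo hl', intervalIntegral.integral_congr_uIoo hr']

theorem intervalIntegral_quadratic (a b p q r : ℝ) :
    ∫ x in a..b, (p + q * x + r * x ^ 2) =
      p * (b - a) + q * (b ^ 2 - a ^ 2) / 2 + r * (b ^ 3 - a ^ 3) / 3 := by
  have hcont {φ : ℝ → ℝ} (hφ : Continuous φ) : IntervalIntegrable φ volume a b :=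
    hφ.intervalIntegrable a b
  rw [intervalIntegral.integral_add (hcont (by fun_prop)) (hcont (by fun_prop)),
    intervalIntegral.integral_add (hcont (by fun_prop)) (hcont (by fun_prop)),
    intervalIntegral.integral_const_mul, intervalIntegral.integral_const_mul,
    intervalIntegral.integral_const, integral_id, integral_pow]
  norm_num
  ring

theorem memLp_id_symmUniform (p : ENNReal) : MemLp (fun x : ℝ => x) p symmUniform := by
  refine .of_bound aestronglyMeasurable_id 1 ?_
  filter_upwards [ae_symmUniform_mem] with x hx using abs_le.2 ⟨hx.1.le, hx.2.le⟩

end UniformLaw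

section Kernels

theorem memLp_ite_one_zero {α : Type*} [MeasurableSpace α] {μ : Measure α} [IsFiniteMeasure μ]
    {s : α → Prop} [DecidablePred s] (hs : MeasurableSet {x | s x}) (p : ENNReal) :
    MemLp (fun x => if s x then (1 : ℝ) else 0) p μ := by
  refine .of_bound (Measurable.ite hs measurable_const measurable_const).aestronglyMeasurable 1
    (.of_forall fun x => ?_)
  split_ifs <;> simp

/-- The degenerate part of the indicator of an inversion `x > y` of two independent variables with
distribution `symmUniform`, whose conditional probabilities are `(1 + x) / 2` and `(1 - y) / 2`. -/
noncomputable def invKernel (p : ℝ × ℝ) : ℝ :=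
  (if p.1 > p.2 then 1 else 0) - 1 / 2 - p.1 / 2 + p.2 / 2

theorem measurable_invKernel : Measurable invKernel := by
  unfold invKernel
  exact (((Measurable.ite (measurableSet_lt measurable_snd measurable_fst) measurable_const
    measurable_const).sub measurable_const).sub (measurable_fst.div_const 2)).add
    (measurable_snd.div_const 2)

theorem memLp_invKernel : MemLp invKernel 2 (symmUniform.prod symmUniform) := by
  have hind := memLp_ite_one_zero (μ := symmUniform.prod symmUniform)
    (measurableSet_lt (measurable_snd (α := ℝ) (β := ℝ)) measurable_fst) 2
  have hid := (memLp_id_symmUniform 2).mul_const 2⁻¹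
  simpa only [invKernel, div_eq_mul_inv] using!
    ((hind.sub (memLp_const (1 / 2))).sub (hid.comp_fst symmUniform)).add
      (hid.comp_snd symmUniform)

theorem invKernel_swap {p : ℝ × ℝ} (hp : p.1 ≠ p.2) : invKernel p.swap = -invKernel p := by
  rcases hp.lt_or_gt with h | h <;>
    simp only [invKernel, Prod.fst_swap, Prod.snd_swap, gt_iff_lt, h, h.not_gt, if_true,
      if_false] <;>
    ring

theorem invKernel_neg_swap (p : ℝ × ℝ) : invKernel (-p.2, p.1) = invKernel (-p.1, p.2) := by
  simp only [invKernel, gt_iff_lt, lt_neg (a := p.1)]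
  ring

theorem integral_invKernel_fst {y : ℝ} (hy : y ∈ Set.Icc (-1) 1) :
    ∫ x, invKernel (x, y) ∂symmUniform = 0 := by
  rw [integral_symmUniform_of_piecewise hy
    (φ := fun x => (-(1 / 2) + y / 2) + (-(1 / 2)) * x + 0 * x ^ 2)
    (ψ := fun x => (1 / 2 + y / 2) + (-(1 / 2)) * x + 0 * x ^ 2) (by fun_prop) (by fun_prop)
    (fun x hx => by rw [invKernel, if_neg hx.not_gt]; ring)
    (fun x hx => by rw [invKernel, if_pos hx]; ring),
    intervalIntegral_quadratic, intervalIntegral_quadratic]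
  ring

theorem integral_invKernel_sq_fst {y : ℝ} (hy : y ∈ Set.Icc (-1) 1) :
    ∫ x, invKernel (x, y) ^ 2 ∂symmUniform = 1 / 12 := by
  rw [integral_symmUniform_of_piecewise hy
    (φ := fun x => (1 - y) ^ 2 / 4 + ((1 - y) / 2) * x + (1 / 4) * x ^ 2)
    (ψ := fun x => (1 + y) ^ 2 / 4 + (-((1 + y) / 2)) * x + (1 / 4) * x ^ 2)
    (by fun_prop) (by fun_prop)
    (fun x hx => by rw [invKernel, if_neg hx.not_gt]; ring)
    (fun x hx => by rw [invKernel, if_pos hx]; ring),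
    intervalIntegral_quadratic, intervalIntegral_quadratic]
  ring

theorem ae_prod_symmUniform_ne : ∀ᵐ p ∂symmUniform.prod symmUniform, p.1 ≠ p.2 := by
  refine (Measure.ae_prod_iff_ae_ae ?_).2 ?_
  · exact (measurableSet_eq_fun measurable_fst measurable_snd).compl
  · exact .of_forall fun x => (symmUniform.ae_ne x).mono fun y hy => hy.symm

theorem isDegenerate_invKernel : IsDegenerate invKernel symmUniform where
  measurable := measurable_invKernel
  memLp := memLp_invKernel
  integral_fst := ae_symmUniform_mem.mono fun _ hy =>
    integral_invKernel_fst (Set.Ioo_subset_Icc_self hy)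
  integral_snd := by
    filter_upwards [ae_symmUniform_mem] with x hx
    calc ∫ y, invKernel (x, y) ∂symmUniform = ∫ y, -invKernel (y, x) ∂symmUniform := by
          refine integral_congr_ae ?_
          filter_upwards [symmUniform.ae_ne x] with y hy
          exact invKernel_swap (p := (y, x)) hy
      _ = 0 := by
          rw [integral_neg, integral_invKernel_fst (Set.Ioo_subset_Icc_self hx), neg_zero]

theorem IsDegenerate.comp_neg_fst {g : ℝ × ℝ → ℝ} (hg : IsDegenerate g symmUniform) :
    IsDegenerate (fun p => g (-p.1, p.2)) symmUniform where
  measurable := hg.measurable.comp (by fun_prop)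
  memLp := hg.memLp.comp_measurePreserving
    (measurePreserving_neg_symmUniform.prod (MeasurePreserving.id symmUniform))
  integral_fst := hg.integral_fst.mono fun y hy => by
    rw [← hy]
    exact measurePreserving_neg_symmUniform.integral_comp
      (Homeomorph.neg ℝ).measurableEmbedding fun x => g (x, y)
  integral_snd := measurePreserving_neg_symmUniform.quasiMeasurePreserving.ae hg.integral_snd

theorem integral_invKernel_sq :
    ∫ p, invKernel p ^ 2 ∂symmUniform.prod symmUniform = 1 / 12 := by
  rw [integral_prod_symm _ memLp_invKernel.integrable_sq, integral_congr_ae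
    (ae_symmUniform_mem.mono fun y hy => integral_invKernel_sq_fst (Set.Ioo_subset_Icc_self hy))]
  simp

theorem integral_invKernel_neg_sq :
    ∫ p, invKernel (-p.1, p.2) ^ 2 ∂symmUniform.prod symmUniform = 1 / 12 := by
  rw [← integral_invKernel_sq]
  exact (measurePreserving_neg_symmUniform.prod (MeasurePreserving.id symmUniform)).integral_comp
    ((Homeomorph.neg ℝ).prodCongr (Homeomorph.refl ℝ)).measurableEmbedding fun p => invKernel p ^ 2

-- Off the diagonal, swapping the variables negates the first factor and fixes the second.
theorem integral_invKernel_mul_invKernel_neg :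
    ∫ p, invKernel p * invKernel (-p.1, p.2) ∂symmUniform.prod symmUniform = 0 := by
  refine self_eq_neg.1 ?_
  rw [← integral_neg]
  calc ∫ p, invKernel p * invKernel (-p.1, p.2) ∂symmUniform.prod symmUniform
      = ∫ p : ℝ × ℝ, invKernel p.swap * invKernel (-p.2, p.1) ∂symmUniform.prod symmUniform :=
        (integral_prod_swap fun p : ℝ × ℝ => invKernel p * invKernel (-p.1, p.2)).symm
    _ = ∫ p, -(invKernel p * invKernel (-p.1, p.2)) ∂symmUniform.prod symmUniform := by
        refine integral_congr_ae ?_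
        filter_upwards [ae_prod_symmUniform_ne] with p hp
        rw [invKernel_swap hp, invKernel_neg_swap, neg_mul]

/-- The interaction of two variables that contributes `a` times the inversion `x > y` and `b` times
the inversion `-x > y`. -/
noncomputable def pairKernel (a b : ℝ) (p : ℝ × ℝ) : ℝ :=
  a * invKernel p + b * invKernel (-p.1, p.2)

theorem isDegenerate_pairKernel (a b : ℝ) : IsDegenerate (pairKernel a b) symmUniform :=
  (isDegenerate_invKernel.const_mul a).add (isDegenerate_invKernel.comp_neg_fst.const_mul b)

theorem integral_pairKernel_sq (a b : ℝ) :
    ∫ p, pairKernel a b p ^ 2 ∂symmUniform.prod symmUniform = (a ^ 2 + b ^ 2) / 12 := by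
  have hκ := isDegenerate_invKernel.memLp
  have hκ' := isDegenerate_invKernel.comp_neg_fst.memLp
  have hexp (p : ℝ × ℝ) : pairKernel a b p ^ 2 = (a ^ 2 * invKernel p ^ 2 +
      b ^ 2 * invKernel (-p.1, p.2) ^ 2) + 2 * a * b * (invKernel p * invKernel (-p.1, p.2)) := by
    rw [pairKernel]; ring
  have hsq : Integrable (fun p => a ^ 2 * invKernel p ^ 2 + b ^ 2 * invKernel (-p.1, p.2) ^ 2)
      (symmUniform.prod symmUniform) :=
    (hκ.integrable_sq.const_mul _).add (hκ'.integrable_sq.const_mul _)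
  have hmul : Integrable (fun p => 2 * a * b * (invKernel p * invKernel (-p.1, p.2)))
      (symmUniform.prod symmUniform) := (hκ.integrable_mul hκ').const_mul _
  simp only [hexp]
  rw [integral_add hsq hmul,
    integral_add (hκ.integrable_sq.const_mul _) (hκ'.integrable_sq.const_mul _),
    integral_const_mul, integral_const_mul, integral_const_mul, integral_invKernel_sq,
    integral_invKernel_neg_sq, integral_invKernel_mul_invKernel_neg]
  ring

/-- The main effect of a variable that contributes `c / 2` times its value and `b` times the
centered indicator of its being negative. -/
noncomputable def mainEffect (c b x : ℝ) : ℝ := c / 2 * x + b * ((if x < 0 then 1 else 0) - 1 / 2)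

theorem isCentered_mainEffect (c b : ℝ) : IsCentered (mainEffect c b) symmUniform where
  measurable := by
    unfold mainEffect
    exact (measurable_id.const_mul _).add (((Measurable.ite measurableSet_Iio measurable_const
      measurable_const).sub measurable_const).const_mul b)
  memLp :=
    ((memLp_id_symmUniform 2).const_mul _).add
      (((memLp_ite_one_zero measurableSet_Iio 2).sub (memLp_const _)).const_mul b)
  integral_eq_zero := by
    rw [integral_symmUniform_of_piecewise (y := 0) (by simp)
      (φ := fun x => b / 2 + (c / 2) * x + 0 * x ^ 2)
      (ψ := fun x => -(b / 2) + (c / 2) * x + 0 * x ^ 2) (by fun_prop) (by fun_prop)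
      (fun x hx => by rw [mainEffect, if_pos hx]; ring)
      (fun x hx => by rw [mainEffect, if_neg hx.not_gt]; ring),
      intervalIntegral_quadratic, intervalIntegral_quadratic]
    ring

theorem integral_mainEffect_sq (c b : ℝ) :
    ∫ x, mainEffect c b x ^ 2 ∂symmUniform = (c ^ 2 - 3 * b * c + 3 * b ^ 2) / 12 := by
  rw [integral_symmUniform_of_piecewise (y := 0) (by simp)
    (φ := fun x => b ^ 2 / 4 + (b * c / 2) * x + (c ^ 2 / 4) * x ^ 2)
    (ψ := fun x => b ^ 2 / 4 + (-(b * c / 2)) * x + (c ^ 2 / 4) * x ^ 2) (by fun_prop) (by fun_prop)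
    (fun x hx => by rw [mainEffect, if_pos hx]; ring)
    (fun x hx => by rw [mainEffect, if_neg hx.not_gt]; ring),
    intervalIntegral_quadratic, intervalIntegral_quadratic]
  ring

end Kernels

section Counting

/-- The number of pairs in `P` with first entry `k`. -/
def fstCount {ι : Type*} [Fintype ι] [DecidableEq ι] (P : Finset (ι × ι)) (k : ι) : ℕ :=
  (Finset.univ.filter fun j => (k, j) ∈ P).card

/-- The number of pairs in `P` with second entry `k`. -/
def sndCount {ι : Type*} [Fintype ι] [DecidableEq ι] (P : Finset (ι × ι)) (k : ι) : ℕ :=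
  (Finset.univ.filter fun i => (i, k) ∈ P).card

theorem sum_comp_fst {ι : Type*} [Fintype ι] [DecidableEq ι] (P : Finset (ι × ι)) (φ : ι → ℝ) :
    ∑ p ∈ P, φ p.1 = ∑ k, (fstCount P k : ℝ) * φ k := by
  rw [Finset.sum_finset_product P Finset.univ fun k => Finset.univ.filter fun j => (k, j) ∈ P]
  · simp only [Finset.sum_const, nsmul_eq_mul, fstCount]
  · simp

theorem sum_comp_snd {ι : Type*} [Fintype ι] [DecidableEq ι] (P : Finset (ι × ι)) (φ : ι → ℝ) :
    ∑ p ∈ P, φ p.2 = ∑ k, (sndCount P k : ℝ) * φ k := by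
  rw [Finset.sum_finset_product_right P Finset.univ fun k => Finset.univ.filter fun i => (i, k) ∈ P]
  · simp only [Finset.sum_const, nsmul_eq_mul, sndCount]
  · simp

theorem card_eq_sum_fstCount {ι : Type*} [Fintype ι] [DecidableEq ι] (P : Finset (ι × ι)) :
    (P.card : ℝ) = ∑ k, (fstCount P k : ℝ) := by
  simpa using sum_comp_fst P fun _ => 1

theorem card_filter_fin_val (n : ℕ) (p : ℕ → Prop) [DecidablePred p] :
    (Finset.univ.filter fun k : Fin n => p k).card = ((Finset.range n).filter p).card := by
  simp only [Finset.card_filter, Fin.sum_univ_eq_sum_range fun i => if p i then 1 else 0]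

theorem fstCount_diffPairs (n d : ℕ) (k : Fin n) :
    fstCount (diffPairs n d) k = min d (n - 1 - k) := by
  have hIoc : (Finset.range n).filter (fun j => (k : ℕ) < j ∧ j ≤ k + d) =
      Finset.Ioc (k : ℕ) (min (k + d) (n - 1)) := by
    ext j
    simp only [Finset.mem_filter, Finset.mem_range, Finset.mem_Ioc]
    omega
  simp only [fstCount, diffPairs, Finset.mem_filter_univ, Fin.lt_def]
  rw [card_filter_fin_val n fun j => (k : ℕ) < j ∧ j ≤ k + d, hIoc, Nat.card_Ioc]
  omega

theorem sndCount_diffPairs (n d : ℕ) (k : Fin n) : sndCount (diffPairs n d) k = min d k := by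
  have hIco : (Finset.range n).filter (fun i => i < (k : ℕ) ∧ (k : ℕ) ≤ i + d) =
      Finset.Ico ((k : ℕ) - d) k := by
    ext i
    simp only [Finset.mem_filter, Finset.mem_range, Finset.mem_Ico]
    omega
  simp only [sndCount, diffPairs, Finset.mem_filter_univ, Fin.lt_def]
  rw [card_filter_fin_val n fun i => i < (k : ℕ) ∧ (k : ℕ) ≤ i + d, hIco, Nat.card_Ico]
  omega

theorem card_filter_fin_le_sub {n e : ℕ} {k : Fin n} {p : Fin n → Prop} [DecidablePred p]
    (hp : ∀ j, p j → (j : ℕ) + k < e) : (Finset.univ.filter p).card ≤ e - k := by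
  rw [← Finset.card_range (e - k), ← Finset.card_map Fin.valEmbedding]
  refine Finset.card_le_card fun i hi => ?_
  obtain ⟨j, hj, rfl⟩ := Finset.mem_map.1 hi
  exact Finset.mem_range.2 (Nat.lt_sub_of_add_lt (hp j (Finset.mem_filter.1 hj).2))

theorem fstCount_sumPairs_le (n e : ℕ) (k : Fin n) : fstCount (sumPairs n e) k ≤ e - k :=
  card_filter_fin_le_sub fun j hj => by
    simp only [sumPairs, Finset.mem_filter_univ] at hj
    omega

theorem sndCount_sumPairs_le (n e : ℕ) (k : Fin n) : sndCount (sumPairs n e) k ≤ e - k :=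
  card_filter_fin_le_sub fun j hj => by
    simp only [sumPairs, Finset.mem_filter_univ] at hj
    omega

theorem card_diffPairs_add_card_sumPairs_le (n d e : ℕ) :
    ((diffPairs n d).card : ℝ) + (sumPairs n e).card ≤ n * (d + e) := by
  rw [card_eq_sum_fstCount, card_eq_sum_fstCount, ← Finset.sum_add_distrib]
  refine (Finset.sum_le_card_nsmul Finset.univ _ (d + e : ℝ) fun k _ => ?_).trans_eq
    (by simp [mul_add])
  have hdiff : fstCount (diffPairs n d) k ≤ d :=
    (fstCount_diffPairs n d k).trans_le (min_le_left _ _)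
  have hsum : fstCount (sumPairs n e) k ≤ e := (fstCount_sumPairs_le n e k).trans (Nat.sub_le _ _)
  exact_mod_cast add_le_add hdiff hsum

-- Every index in the lower half of the range is the first entry of at least `d / 8` pairs.
theorem le_card_diffPairs {n d : ℕ} (hdn : d ≤ 2 * n) (hn : 2 ≤ n) :
    (n * d : ℝ) / 16 ≤ (diffPairs n d).card := by
  set A : Finset (Fin n) := Finset.univ.filter fun k => 2 * (k : ℕ) < n with hA
  have hcard : (n : ℝ) / 2 ≤ A.card := by
    have hrange : (Finset.range n).filter (fun k => 2 * k < n) = Finset.range ((n + 1) / 2) := by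
      ext k
      simp only [Finset.mem_filter, Finset.mem_range]
      omega
    rw [hA, card_filter_fin_val n fun k => 2 * k < n, hrange, Finset.card_range,
      div_le_iff₀ two_pos]
    exact_mod_cast (by omega : n ≤ (n + 1) / 2 * 2)
  have hcount : ∀ k ∈ A, (d : ℝ) / 8 ≤ fstCount (diffPairs n d) k := fun k hk => by
    have hk' := (Finset.mem_filter.1 hk).2
    rw [fstCount_diffPairs, div_le_iff₀ (by norm_num)]
    exact_mod_cast (by omega : d ≤ min d (n - 1 - k) * 8)
  calc (n * d : ℝ) / 16 = (n / 2) * (d / 8) := by ring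
    _ ≤ A.card * ((d : ℝ) / 8) := by gcongr
    _ = A.card • ((d : ℝ) / 8) := (nsmul_eq_mul _ _).symm
    _ ≤ ∑ k ∈ A, (fstCount (diffPairs n d) k : ℝ) := Finset.card_nsmul_le_sum _ _ _ hcount
    _ ≤ ∑ k, (fstCount (diffPairs n d) k : ℝ) :=
        Finset.sum_le_univ_sum_of_nonneg fun k => Nat.cast_nonneg _
    _ = (diffPairs n d).card := (card_eq_sum_fstCount _).symm

end Counting

section MainEffects

/-- Twice the coefficient of the `k`-th variable in the linear part of `diffInv n d + sumInv n e`: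
by the conditional probabilities `(1 + x) / 2`, `(1 - y) / 2` of `x > y` and `(1 - x) / 2`,
`(1 - y) / 2` of `-x > y`, only the first entries of `diffPairs` count positively. -/
def linCoeff (n d e : ℕ) (k : Fin n) : ℝ :=
  fstCount (diffPairs n d) k - sndCount (diffPairs n d) k
    - fstCount (sumPairs n e) k - sndCount (sumPairs n e) k

/-- Twelve times the variance of the main effect of the `k`-th variable in
`diffInv n d + sumInv n e + negCount n f`. -/
noncomputable def mainVar (n d e f : ℕ) (k : Fin n) : ℝ :=
  linCoeff n d e k ^ 2 + if (k : ℕ) + 1 ≤ f then 3 - 3 * linCoeff n d e k else 0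

theorem mainVar_nonneg (n d e f : ℕ) (k : Fin n) : 0 ≤ mainVar n d e f k := by
  rw [mainVar]
  split_ifs
  · linarith [sq_nonneg (linCoeff n d e k - 3 / 2)]
  · positivity

theorem abs_linCoeff_le {n d e M : ℕ} (hd : d ≤ M) (he : e ≤ M) (k : Fin n) :
    |linCoeff n d e k| ≤ 3 * M := by
  have h₁ : fstCount (diffPairs n d) k ≤ M := by rw [fstCount_diffPairs]; omega
  have h₂ : sndCount (diffPairs n d) k ≤ M := by rw [sndCount_diffPairs]; omega
  have h₃ : fstCount (sumPairs n e) k ≤ M := (fstCount_sumPairs_le n e k).trans (by omega)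
  have h₄ : sndCount (sumPairs n e) k ≤ M := (sndCount_sumPairs_le n e k).trans (by omega)
  rify at h₁ h₂ h₃ h₄
  rw [linCoeff, abs_le]
  constructor <;> linarith [(fstCount (diffPairs n d) k).cast_nonneg (α := ℝ),
    (sndCount (diffPairs n d) k).cast_nonneg (α := ℝ),
    (fstCount (sumPairs n e) k).cast_nonneg (α := ℝ),
    (sndCount (sumPairs n e) k).cast_nonneg (α := ℝ)]

theorem linCoeff_eq_zero {n d e : ℕ} {k : Fin n} (hd : d ≤ k) (he : e ≤ k) (hk : k + d < n) :
    linCoeff n d e k = 0 := by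
  have h₁ : fstCount (diffPairs n d) k = d := by rw [fstCount_diffPairs]; omega
  have h₂ : sndCount (diffPairs n d) k = d := by rw [sndCount_diffPairs]; omega
  have h₃ : fstCount (sumPairs n e) k = 0 :=
    Nat.eq_zero_of_le_zero ((fstCount_sumPairs_le n e k).trans_eq (Nat.sub_eq_zero_of_le he))
  have h₄ : sndCount (sumPairs n e) k = 0 :=
    Nat.eq_zero_of_le_zero ((sndCount_sumPairs_le n e k).trans_eq (Nat.sub_eq_zero_of_le he))
  simp [linCoeff, h₁, h₂, h₃, h₄]

theorem linCoeff_le_neg {n d e : ℕ} (hdn : d ≤ 2 * n) (hn : 4 ≤ n) {k : Fin n}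
    (hk : n ≤ k + 1 + d / 8) : linCoeff n d e k ≤ -(d / 8) := by
  have h : d + 8 * fstCount (diffPairs n d) k ≤ 8 * sndCount (diffPairs n d) k := by
    rw [fstCount_diffPairs, sndCount_diffPairs]
    omega
  rify at h
  rw [linCoeff]
  linarith [(fstCount (sumPairs n e) k).cast_nonneg (α := ℝ),
    (sndCount (sumPairs n e) k).cast_nonneg (α := ℝ)]

theorem mainVar_le {n d e M : ℕ} (hd : d ≤ M) (he : e ≤ M) (hM : 1 ≤ M) (f : ℕ) (k : Fin n) :
    mainVar n d e f k ≤ 21 * M ^ 2 := by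
  have hc := abs_le.1 (abs_linCoeff_le hd he k)
  have hsq : linCoeff n d e k ^ 2 ≤ (3 * M) ^ 2 := sq_le_sq' hc.1 hc.2
  have hM' : (1 : ℝ) ≤ M := by exact_mod_cast hM
  rw [mainVar]
  split_ifs <;> nlinarith

theorem mainVar_eq_zero {n d e f : ℕ} {k : Fin n} (hd : d ≤ k) (he : e ≤ k) (hf : f ≤ k)
    (hk : k + d < n) : mainVar n d e f k = 0 := by
  rw [mainVar, linCoeff_eq_zero hd he hk, if_neg (by omega)]
  norm_num

theorem sum_mainVar_le {n d e f M : ℕ} (hd : d ≤ M) (he : e ≤ M) (hf : f ≤ M) (hM : 1 ≤ M) :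
    ∑ k, mainVar n d e f k ≤ 42 * M ^ 3 := by
  set A : Finset (Fin n) := Finset.univ.filter fun k => (k : ℕ) < M ∨ n ≤ k + d with hA
  have hcard : (A.card : ℝ) ≤ 2 * M := by
    have hsub : (Finset.range n).filter (fun k => k < M ∨ n ≤ k + d) ⊆
        Finset.range M ∪ Finset.Ico (n - d) n := fun k hk => by
      simp only [Finset.mem_filter, Finset.mem_range, Finset.mem_union, Finset.mem_Ico] at hk ⊢
      omega
    have h := (Finset.card_le_card hsub).trans (Finset.card_union_le _ _)
    rw [← card_filter_fin_val n fun k => k < M ∨ n ≤ k + d, ← hA, Finset.card_range,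
      Nat.card_Ico] at h
    exact_mod_cast (by omega : A.card ≤ 2 * M)
  calc ∑ k, mainVar n d e f k = ∑ k ∈ A, mainVar n d e f k := by
        refine (Finset.sum_subset (Finset.subset_univ A) fun k _ hk => ?_).symm
        simp only [hA, Finset.mem_filter_univ, not_or, not_lt, not_le] at hk
        exact mainVar_eq_zero (hd.trans hk.1) (he.trans hk.1) (hf.trans hk.1) hk.2
    _ ≤ A.card • (21 * (M : ℝ) ^ 2) :=
        Finset.sum_le_card_nsmul _ _ _ fun k _ => mainVar_le hd he hM f k
    _ = A.card * (21 * (M : ℝ) ^ 2) := nsmul_eq_mul _ _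
    _ ≤ 2 * M * (21 * (M : ℝ) ^ 2) := by gcongr
    _ = 42 * (M : ℝ) ^ 3 := by ring

theorem le_sum_mainVar {n d : ℕ} (hdn : d ≤ 2 * n) (hn : 4 ≤ n) (e f : ℕ) :
    (d : ℝ) ^ 3 / 512 ≤ ∑ k, mainVar n d e f k := by
  set A : Finset (Fin n) := Finset.univ.filter fun k => n ≤ k + 1 + d / 8 with hA
  have hcard : (d : ℝ) / 8 ≤ A.card := by
    have hIco : (Finset.range n).filter (fun k => n ≤ k + 1 + d / 8) =
        Finset.Ico (n - 1 - d / 8) n := by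
      ext k
      simp only [Finset.mem_filter, Finset.mem_range, Finset.mem_Ico]
      omega
    rw [hA, card_filter_fin_val n fun k => n ≤ k + 1 + d / 8, hIco, Nat.card_Ico,
      div_le_iff₀ (by norm_num)]
    exact_mod_cast (by omega : d ≤ (n - (n - 1 - d / 8)) * 8)
  have hlower : ∀ k ∈ A, (d : ℝ) ^ 2 / 64 ≤ mainVar n d e f k := fun k hk => by
    have hc := linCoeff_le_neg (e := e) hdn hn (Finset.mem_filter.1 hk).2
    rw [mainVar]
    split_ifs <;> nlinarith [d.cast_nonneg (α := ℝ)]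
  calc (d : ℝ) ^ 3 / 512 = (d / 8) * (d ^ 2 / 64) := by ring
    _ ≤ A.card * ((d : ℝ) ^ 2 / 64) := by gcongr
    _ = A.card • ((d : ℝ) ^ 2 / 64) := (nsmul_eq_mul _ _).symm
    _ ≤ ∑ k ∈ A, mainVar n d e f k := Finset.card_nsmul_le_sum _ _ _ hlower
    _ ≤ ∑ k, mainVar n d e f k :=
        Finset.sum_le_univ_sum_of_nonneg fun k => mainVar_nonneg n d e f k

end MainEffects

section Statistic

/-- The number of inversions at the positive roots `e_i - e_j` of height at most `d`, `e_i + e_j`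
with `i + j ≤ e`, and `e_i` with `i ≤ f`: every `genInv` is of this form. -/
noncomputable def rootInv (n d e f : ℕ) (z : Fin n → ℝ) : ℝ :=
  diffInv n d z + sumInv n e z + negCount n f z

/-- The main effects of the single variables in the Hoeffding decomposition of `rootInv`. -/
noncomputable def rootMain (n d e f : ℕ) (k : Fin n) : ℝ → ℝ :=
  mainEffect (linCoeff n d e k) (if (k : ℕ) + 1 ≤ f then 1 else 0)

/-- The interactions of pairs of variables in the Hoeffding decomposition of `rootInv`. -/
noncomputable def rootInteraction (n d e : ℕ) (p : Fin n × Fin n) : ℝ × ℝ → ℝ :=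
  pairKernel (if p ∈ diffPairs n d then 1 else 0) (if p ∈ sumPairs n e then 1 else 0)

theorem fst_lt_snd_of_mem {n d e : ℕ} {p : Fin n × Fin n}
    (hp : p ∈ diffPairs n d ∪ sumPairs n e) : p.1 < p.2 :=
  (Finset.mem_union.1 hp).elim (fun h => (Finset.mem_filter.1 h).2.1)
    fun h => (Finset.mem_filter.1 h).2.1

theorem diffInv_eq (n d : ℕ) (z : Fin n → ℝ) :
    diffInv n d z = (diffPairs n d).card / 2 +
      ∑ k, ((fstCount (diffPairs n d) k : ℝ) - sndCount (diffPairs n d) k) / 2 * z k +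
      ∑ p ∈ diffPairs n d, invKernel (z p.1, z p.2) := by
  have hsplit (p : Fin n × Fin n) : (if z p.1 > z p.2 then (1 : ℝ) else 0) =
      1 / 2 + (z p.1 / 2 - z p.2 / 2) + invKernel (z p.1, z p.2) := by rw [invKernel]; ring
  simp only [diffInv, hsplit, Finset.sum_add_distrib, Finset.sum_sub_distrib, Finset.sum_const,
    nsmul_eq_mul, sum_comp_fst _ fun k => z k / 2, sum_comp_snd _ fun k => z k / 2, sub_div,
    sub_mul, div_mul_eq_mul_div, mul_div_assoc', mul_one]

theorem sumInv_eq (n e : ℕ) (z : Fin n → ℝ) :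
    sumInv n e z = (sumPairs n e).card / 2 -
      ∑ k, ((fstCount (sumPairs n e) k : ℝ) + sndCount (sumPairs n e) k) / 2 * z k +
      ∑ p ∈ sumPairs n e, invKernel (-z p.1, z p.2) := by
  have hsplit (p : Fin n × Fin n) : (if -z p.1 > z p.2 then (1 : ℝ) else 0) =
      1 / 2 - (z p.1 / 2 + z p.2 / 2) + invKernel (-z p.1, z p.2) := by rw [invKernel]; ring
  simp only [sumInv, hsplit, Finset.sum_add_distrib, Finset.sum_sub_distrib, Finset.sum_const,
    nsmul_eq_mul, sum_comp_fst _ fun k => z k / 2, sum_comp_snd _ fun k => z k / 2, add_div,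
    add_mul, div_mul_eq_mul_div, mul_div_assoc', mul_one]

theorem negCount_eq (n f : ℕ) (z : Fin n → ℝ) :
    negCount n f z = (Finset.univ.filter fun k : Fin n => (k : ℕ) + 1 ≤ f).card / 2 +
      ∑ k : Fin n, (if (k : ℕ) + 1 ≤ f then 1 else 0) * ((if z k < 0 then 1 else 0) - 1 / 2) := by
  simp only [negCount, ite_mul, one_mul, zero_mul, ← Finset.sum_filter, Finset.sum_sub_distrib,
    Finset.sum_const, nsmul_eq_mul]
  ring

theorem sum_rootInteraction (n d e : ℕ) (z : Fin n → ℝ) :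
    ∑ p ∈ diffPairs n d ∪ sumPairs n e, rootInteraction n d e p (z p.1, z p.2) =
      ∑ p ∈ diffPairs n d, invKernel (z p.1, z p.2) +
        ∑ p ∈ sumPairs n e, invKernel (-z p.1, z p.2) := by
  simp only [rootInteraction, pairKernel, ite_mul, one_mul, zero_mul, Finset.sum_add_distrib,
    Finset.sum_ite_mem, Finset.union_inter_cancel_left, Finset.union_inter_cancel_right]

theorem rootInv_eq_hoeffdingSum (n d e f : ℕ) (z : Fin n → ℝ) :
    rootInv n d e f z = hoeffdingSum
      (((diffPairs n d).card + (sumPairs n e).card +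
        (Finset.univ.filter fun k : Fin n => (k : ℕ) + 1 ≤ f).card) / 2)
      (rootMain n d e f) (diffPairs n d ∪ sumPairs n e) (rootInteraction n d e) z := by
  have hmain : ∑ k, rootMain n d e f k (z k) =
      ∑ k, ((fstCount (diffPairs n d) k : ℝ) - sndCount (diffPairs n d) k) / 2 * z k -
      ∑ k, ((fstCount (sumPairs n e) k : ℝ) + sndCount (sumPairs n e) k) / 2 * z k +
      ∑ k : Fin n, (if (k : ℕ) + 1 ≤ f then 1 else 0) * ((if z k < 0 then 1 else 0) - 1 / 2) := by
    rw [← Finset.sum_sub_distrib, ← Finset.sum_add_distrib]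
    refine Finset.sum_congr rfl fun k _ => ?_
    rw [rootMain, mainEffect, linCoeff]
    ring
  rw [rootInv, hoeffdingSum, diffInv_eq, sumInv_eq, negCount_eq, sum_rootInteraction, hmain]
  ring

theorem isCentered_rootMain (n d e f : ℕ) (k : Fin n) :
    IsCentered (rootMain n d e f k) symmUniform :=
  isCentered_mainEffect _ _

theorem isDegenerate_rootInteraction (n d e : ℕ) (p : Fin n × Fin n) :
    IsDegenerate (rootInteraction n d e p) symmUniform :=
  isDegenerate_pairKernel _ _

theorem integral_rootMain_sq (n d e f : ℕ) (k : Fin n) :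
    ∫ x, rootMain n d e f k x ^ 2 ∂symmUniform = mainVar n d e f k / 12 := by
  rw [rootMain, integral_mainEffect_sq, mainVar]
  split_ifs <;> ring

theorem sum_integral_rootInteraction_sq (n d e : ℕ) :
    ∑ p ∈ diffPairs n d ∪ sumPairs n e,
        ∫ x, rootInteraction n d e p x ^ 2 ∂symmUniform.prod symmUniform =
      ((diffPairs n d).card + (sumPairs n e).card) / 12 := by
  simp only [rootInteraction, integral_pairKernel_sq, ← Finset.sum_div, ite_pow, one_pow,
    zero_pow two_ne_zero, Finset.sum_add_distrib, Finset.sum_ite_mem,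
    Finset.union_inter_cancel_left, Finset.union_inter_cancel_right, Finset.sum_const,
    nsmul_eq_mul, mul_one]

variable {Ω : Type*} [MeasurableSpace Ω] {μ : Measure Ω} [IsProbabilityMeasure μ] {n : ℕ}
  {U : Fin n → Ω → ℝ} (hU : ∀ k, MeasurePreserving (U k) μ symmUniform) (hindep : iIndepFun U μ)

include hU hindep

theorem variance_rootInv (d e f : ℕ) :
    Var[fun ω => rootInv n d e f fun k => U k ω; μ] = (∑ k, mainVar n d e f k) / 12 +
      ((diffPairs n d).card + (sumPairs n e).card) / 12 := by
  simp only [rootInv_eq_hoeffdingSum]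
  rw [variance_hoeffdingSum hU hindep (isCentered_rootMain n d e f)
    (isDegenerate_rootInteraction n d e) fun p => fst_lt_snd_of_mem,
    sum_integral_rootInteraction_sq]
  simp only [integral_rootMain_sq, Finset.sum_div]

theorem variance_hajekProjection_rootInv (d e f : ℕ) :
    Var[hajekProjection μ U fun ω => rootInv n d e f fun k => U k ω; μ] =
      (∑ k, mainVar n d e f k) / 12 := by
  simp only [rootInv_eq_hoeffdingSum]
  rw [variance_hajekProjection_hoeffdingSum hU hindep (isCentered_rootMain n d e f)
    (isDegenerate_rootInteraction n d e) fun p => fst_lt_snd_of_mem]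
  simp only [integral_rootMain_sq, Finset.sum_div]

end Statistic

section Weyl

/-- The bound on `i + j` for the roots `e_i + e_j` counted by `genInv`; no such roots exist in the
symmetric groups. -/
def WeylFamily.sumHeight : WeylFamily → ℕ → ℕ
  | S, _ => 0
  | B, d => d
  | D, d => d + 2

/-- The bound on `i` for the roots `e_i` counted by `genInv`; such roots exist only in type `B`. -/
def WeylFamily.negHeight : WeylFamily → ℕ → ℕ
  | S, _ => 0
  | B, d => d
  | D, _ => 0

theorem sumInv_zero (n : ℕ) (z : Fin n → ℝ) : sumInv n 0 z = 0 := by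
  simp [sumInv, sumPairs]

theorem negCount_zero (n : ℕ) (z : Fin n → ℝ) : negCount n 0 z = 0 := by
  simp [negCount]

/-- The increasing map from the range of the variables of a family onto `(-1, 1)`. -/
def WeylFamily.toSymm : WeylFamily → ℝ → ℝ
  | S => fun x => 2 * x - 1
  | B => id
  | D => id

theorem WeylFamily.measurableEmbedding_toSymm (W : WeylFamily) : MeasurableEmbedding W.toSymm := by
  cases W
  case S =>
    have h : toSymm S = affineHomeomorph (2 : ℝ) (-1) two_ne_zero := by
      ext x
      simp only [toSymm, affineHomeomorph_apply, sub_eq_add_neg]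
    exact h ▸ (affineHomeomorph (2 : ℝ) (-1) two_ne_zero).measurableEmbedding
  case B => exact .id
  case D => exact .id

theorem WeylFamily.preimage_toSymm_Ioo (W : WeylFamily) :
    W.toSymm ⁻¹' Set.Ioo (-1) 1 = W.range := by
  cases W
  case S =>
    ext x
    simp only [toSymm, range, Set.mem_preimage, Set.mem_Ioo]
    constructor <;> rintro ⟨_, _⟩ <;> constructor <;> linarith
  case B => rfl
  case D => rfl

theorem WeylFamily.map_toSymm_volume (W : WeylFamily) :
    ∃ c : ENNReal, c ≠ 0 ∧ c ≠ ⊤ ∧ volume.map W.toSymm = c • volume := by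
  cases W
  case S =>
    refine ⟨ENNReal.ofReal |2⁻¹|, by simp, ENNReal.ofReal_ne_top, ?_⟩
    calc volume.map (fun x : ℝ => 2 * x - 1)
        = (volume.map fun x : ℝ => 2 * x).map fun x => x - 1 :=
          (Measure.map_map (measurable_sub_const 1) (measurable_const_mul 2)).symm
      _ = ENNReal.ofReal |2⁻¹| • volume := by
          rw [Real.map_volume_mul_left two_ne_zero, Measure.map_smul, map_sub_right_eq_self]
  case B => exact ⟨1, one_ne_zero, ENNReal.one_ne_top, by rw [one_smul]; exact Measure.map_id⟩
  case D => exact ⟨1, one_ne_zero, ENNReal.one_ne_top, by rw [one_smul]; exact Measure.map_id⟩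

theorem genInv_comp_toSymm (W : WeylFamily) (n d : ℕ) (z : Fin n → ℝ) :
    genInv W n d (fun k => W.toSymm (z k)) = genInv W n d z := by
  cases W
  case S => simp [genInv, WeylFamily.toSymm, diffInv]
  case B => rfl
  case D => rfl

theorem genInv_eq_rootInv (W : WeylFamily) (n d : ℕ) (z : Fin n → ℝ) :
    genInv W n d z =
      rootInv n d (W.sumHeight d) (W.negHeight d) fun k => W.toSymm (z k) := by
  rw [← genInv_comp_toSymm]
  cases W <;> simp only [genInv, rootInv, WeylFamily.sumHeight, WeylFamily.negHeight, sumInv_zero,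
    negCount_zero, add_zero]

theorem WeylFamily.measurePreserving_toSymm (W : WeylFamily) :
    MeasurePreserving W.toSymm volume[|W.range] symmUniform := by
  obtain ⟨c, hc, hc', hmap⟩ := W.map_toSymm_volume
  rw [← W.preimage_toSymm_Ioo]
  exact measurePreserving_cond_preimage W.measurableEmbedding_toSymm.measurable hc hc' hmap
    measurableSet_Ioo

variable {Ω : Type*} [MeasurableSpace Ω] {μ : Measure Ω} [IsProbabilityMeasure μ] {n : ℕ}
  {Z : Fin n → Ω → ℝ} {W : WeylFamily} (hmeas : ∀ k, Measurable (Z k)) (hindep : iIndepFun Z μ)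
  (hunif : ∀ k, pdf.IsUniform (Z k) W.range μ volume)

include hmeas hindep hunif

theorem variance_genInv (d : ℕ) :
    Var[fun ω => genInv W n d fun k => Z k ω; μ] =
      (∑ k, mainVar n d (W.sumHeight d) (W.negHeight d) k) / 12 +
        ((diffPairs n d).card + (sumPairs n (W.sumHeight d)).card) / 12 := by
  simp only [genInv_eq_rootInv]
  exact variance_rootInv (fun k => W.measurePreserving_toSymm.comp ⟨hmeas k, hunif k⟩)
    (hindep.comp (fun _ => W.toSymm) fun _ => W.measurableEmbedding_toSymm.measurable) _ _ _

theorem variance_hajekProjection_genInv (d : ℕ) :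
    Var[hajekProjection μ Z fun ω => genInv W n d fun k => Z k ω; μ] =
      (∑ k, mainVar n d (W.sumHeight d) (W.negHeight d) k) / 12 := by
  rw [← hajekProjection_comp μ Z _ W.measurableEmbedding_toSymm]
  simp only [genInv_eq_rootInv]
  exact variance_hajekProjection_rootInv
    (fun k => W.measurePreserving_toSymm.comp ⟨hmeas k, hunif k⟩)
    (hindep.comp (fun _ => W.toSymm) fun _ => W.measurableEmbedding_toSymm.measurable) _ _ _

end Weyl

section Asymptotics

theorem isTheta_of_eventually_mem_Icc {α : Type*} {l : Filter α} {u w : α → ℝ} {c C : ℝ}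
    (hc : 0 < c) (hw : ∀ a, 0 ≤ w a) (hu : ∀ᶠ a in l, u a ∈ Set.Icc (c * w a) (C * w a)) :
    u =Θ[l] w := by
  constructor
  · refine .of_bound C (hu.mono fun a ha => ?_)
    rw [Real.norm_of_nonneg ((mul_nonneg hc.le (hw a)).trans ha.1), Real.norm_of_nonneg (hw a)]
    exact ha.2
  · refine .of_bound c⁻¹ (hu.mono fun a ha => ?_)
    rw [Real.norm_of_nonneg ((mul_nonneg hc.le (hw a)).trans ha.1), Real.norm_of_nonneg (hw a)]
    exact (le_inv_mul_iff₀ hc).2 ha.1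

theorem isEquivalent_add_right_iff_isLittleO {α : Type*} {l : Filter α} {v q : α → ℝ} :
    v ~[l] (fun a => v a + q a) ↔ q =o[l] v := by
  have hsub : (fun a => v a + q a) - v = q := by ext; simp
  exact ⟨fun h => by simpa only [IsEquivalent, hsub] using h.symm,
    fun h => IsEquivalent.symm (by simpa only [IsEquivalent, hsub] using h)⟩

theorem isEquivalent_add_iff_sqrt_isLittleO {v q : ℕ → ℝ} {d : ℕ → ℕ}
    (hd : ∀ᶠ n in atTop, d n ≠ 0) (hv : v =Θ[atTop] fun n => (d n : ℝ) ^ 3)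
    (hq : q =Θ[atTop] fun n : ℕ => (d n * n : ℝ)) :
    v ~[atTop] (fun n => v n + q n) ↔
      (fun n : ℕ => √(n : ℝ)) =o[atTop] fun n => (d n : ℝ) := by
  have hd' : ∀ᶠ n in atTop, (d n : ℝ) ≠ 0 := hd.mono fun n hn => Nat.cast_ne_zero.2 hn
  have hdiv : (fun n => (d n : ℝ) ^ 3 / d n) =ᶠ[atTop] fun n => (d n : ℝ) ^ 2 :=
    hd'.mono fun n hn => by field_simp
  calc v ~[atTop] (fun n => v n + q n)
      ↔ (fun n : ℕ => (d n * n : ℝ)) =o[atTop] (fun n => (d n : ℝ) ^ 3) := by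
        rw [isEquivalent_add_right_iff_isLittleO, hq.isLittleO_congr_left,
          hv.isLittleO_congr_right]
    _ ↔ (fun n : ℕ => (n : ℝ)) =o[atTop] (fun n => (d n : ℝ) ^ 2) := by
        rw [isLittleO_mul_iff_isLittleO_div hd', isLittleO_congr .rfl hdiv]
    _ ↔ (fun n : ℕ => √(n : ℝ) ^ 2) =o[atTop] (fun n => (d n : ℝ) ^ 2) := by
        simp only [Real.sq_sqrt (Nat.cast_nonneg _)]
    _ ↔ _ := ⟨fun h => h.of_pow two_ne_zero, fun h => h.pow two_pos⟩

end Asymptotics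

section Bounds

variable {W : WeylFamily} {n d : ℕ}

theorem WeylFamily.le_two_mul_of_le_dMax_sub_one (h : d ≤ W.dMax n - 1) : d ≤ 2 * n := by
  cases W <;> simp only [dMax] at h <;> omega

theorem WeylFamily.sumHeight_le (hd : 1 ≤ d) : W.sumHeight d ≤ 3 * d := by
  cases W <;> simp only [sumHeight] <;> omega

theorem WeylFamily.negHeight_le : W.negHeight d ≤ 3 * d := by
  cases W <;> simp only [negHeight] <;> omega

theorem sum_mainVar_mem_Icc (hd : 1 ≤ d) (hdn : d ≤ 2 * n) (hn : 4 ≤ n) :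
    (∑ k, mainVar n d (W.sumHeight d) (W.negHeight d) k) / 12 ∈
      Set.Icc (1 / 6144 * (d : ℝ) ^ 3) (95 * (d : ℝ) ^ 3) := by
  have hle := sum_mainVar_le (n := n) (d := d) (M := 3 * d) (by omega) (W.sumHeight_le hd)
    W.negHeight_le (by omega)
  have hge := le_sum_mainVar hdn hn (W.sumHeight d) (W.negHeight d)
  push_cast at hle
  constructor <;> linarith [pow_nonneg (d.cast_nonneg (α := ℝ)) 3]

theorem card_pairs_mem_Icc (hd : 1 ≤ d) (hdn : d ≤ 2 * n) (hn : 2 ≤ n) :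
    (((diffPairs n d).card : ℝ) + (sumPairs n (W.sumHeight d)).card) / 12 ∈
      Set.Icc (1 / 192 * (d * n : ℝ)) (1 * (d * n : ℝ)) := by
  have hle := card_diffPairs_add_card_sumPairs_le n d (W.sumHeight d)
  have hge := le_card_diffPairs hdn hn
  have he : (W.sumHeight d : ℝ) ≤ 3 * d := by exact_mod_cast W.sumHeight_le hd
  have hne := mul_le_mul_of_nonneg_left he (n.cast_nonneg (α := ℝ))
  constructor <;> linarith [(sumPairs n (W.sumHeight d)).card.cast_nonneg (α := ℝ),
    mul_nonneg (d.cast_nonneg (α := ℝ)) (n.cast_nonneg (α := ℝ))]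

variable {W : ℕ → WeylFamily} {d : ℕ → ℕ} (hd : ∀ᶠ n in atTop, 1 ≤ d n ∧ d n ≤ 2 * n)

include hd

theorem isTheta_sum_mainVar :
    (fun n => (∑ k, mainVar n (d n) ((W n).sumHeight (d n)) ((W n).negHeight (d n)) k) / 12)
      =Θ[atTop] fun n => (d n : ℝ) ^ 3 := by
  refine isTheta_of_eventually_mem_Icc (c := 1 / 6144) (C := 95) (by norm_num)
    (fun n => by positivity) ?_
  filter_upwards [hd, eventually_ge_atTop 4] with n hd hn
  exact sum_mainVar_mem_Icc hd.1 hd.2 hn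

theorem isTheta_card_pairs :
    (fun n => (((diffPairs n (d n)).card : ℝ) + (sumPairs n ((W n).sumHeight (d n))).card) / 12)
      =Θ[atTop] fun n => (d n * n : ℝ) := by
  refine isTheta_of_eventually_mem_Icc (c := 1 / 192) (C := 1) (by norm_num)
    (fun n => by positivity) ?_
  filter_upwards [hd, eventually_ge_atTop 2] with n hd hn
  exact card_pairs_mem_Icc hd.1 hd.2 hn

end Bounds

theorem lemma3p1
    (W : ℕ → WeylFamily) (d : ℕ → ℕ)
    (hd : ∀ᶠ n in atTop, 1 ≤ d n ∧ d n ≤ (W n).dMax n - 1)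
    {Ω : ℕ → Type*} [∀ n, MeasurableSpace (Ω n)]
    (μ : ∀ n, Measure (Ω n)) [∀ n, IsProbabilityMeasure (μ n)]
    (Z : ∀ n, Fin n → Ω n → ℝ)
    (hZ_meas : ∀ n k, Measurable (Z n k))
    (hZ_indep : ∀ n, iIndepFun (Z n) (μ n))
    (hZ_unif : ∀ n k, pdf.IsUniform (Z n k) (W n).range (μ n) volume) :
    let X : ∀ n, Ω n → ℝ := fun n ω => genInv (W n) n (d n) (fun k => Z n k ω)
    (fun n => variance (hajekProjection (μ n) (Z n) (X n)) (μ n))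
        ~[atTop] (fun n => variance (X n) (μ n)) ↔
      (fun n : ℕ => √(n : ℝ)) =o[atTop] (fun n => (d n : ℝ)) := by
  intro X
  have hproj n := variance_hajekProjection_genInv (hZ_meas n) (hZ_indep n) (hZ_unif n) (d n)
  have hvar n := variance_genInv (hZ_meas n) (hZ_indep n) (hZ_unif n) (d n)
  have hdn : ∀ᶠ n in atTop, 1 ≤ d n ∧ d n ≤ 2 * n :=
    hd.mono fun n hn => ⟨hn.1, WeylFamily.le_two_mul_of_le_dMax_sub_one hn.2⟩
  simp only [X, hproj, hvar]
  exact isEquivalent_add_iff_sqrt_isLittleO (hdn.mono fun n hn => Nat.one_le_iff_ne_zero.1 hn.1)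
    (isTheta_sum_mainVar hdn) (isTheta_card_pairs hdn)
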